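/- Let $k\ge 2$ be an integer, let $\mathbb N=\{0,1,2,\dots\}$, and let $\mathbb N_\infty=\mathbb N\cup\{\infty\}$ be the semiring of extended non-negative integers, with $a+\infty=\infty$, $a\cdot\infty=\infty$ for $a\neq 0$, and $0\cdot\infty=0$. A sequence $\mathbf x=x(0)x(1)x(2)\cdots$ is $k$-automatic if some deterministic finite automaton with output, reading the canonical base-$k$ expansion of $n$, outputs $x(n)$ for every $n\ge 0$. For a semiring $R$, a sequence $f:\mathbb N\to R$ is $(R,k)$-regular if there are finitely many sequences $f_1,\dots,f_r:\mathbb N\to R$ such that $f$ is an $R$-linear combination of $f_1,\dots,f_r$ and, for all $1\le i\le r$ and $0\le a<k$, the sequence $(f_i(kn+a))_{n\ge 0}$ is an $R$-linear combination of $f_1,\dots,f_r$. For an infinite word $\mathbf x$ and $n\ge 0$, define the following elements of $\mathbb N_\infty$ (a minimum over the empty set is $\infty$): - the recurrence function $R_{\mathbf x}(n)$, the least $t$ such that every factor of length $t$ of $\mathbf x$ contains every factor of length $n$ of $\mathbf x$ as a factor; - the appearance function $A_{\mathbf x}(n)$, the least $t$ such that every factor of length $n$ of $\mathbf x$ appears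 in the prefix of length $t$ of $\mathbf x$; - the separator length $S_{\mathbf x}(n)$, for $n\ge 1$, the length of the shortest factor that begins at position $n$ of $\mathbf x$ and does not begin at any position $j<n$; the value $S_{\mathbf x}(0)$ may be any fixed element of $\mathbb N$ (or of $\mathbb N_\infty$, where regularity over $\mathbb N_\infty$ is concerned); - the repetitivity index $I_{\mathbf x}(n)$, the minimum distance between two consecutive occurrences in $\mathbf x$ of the same factor of length $n$. **Theorem.** Let $\mathbf x$ be $k$-automatic. Then: 1. $(R_{\mathbf x}(n))_{n\ge 0}$ is $(\mathbb N_\infty,k)$-regular. 2. $A_{\mathbf x}(n)$ is finite for all $n$, and $(A_{\mathbf x}(n))_{n\ge 0}$ is $(\mathbb N,k)$-regular. 3. $(S_{\mathbf x}(n))_{n\ge 0}$ is $(\mathbb N_\infty,k)$-regular; if $\mathbf x$ is not ultimately periodic, then $S_{\mathbf x}(n)$ is finite for all $n$, and $(S_{\mathbf x}(n))_{n\ge 0}$ is $(\mathbb N,k)$-regular. 4. $I_{\mathbf x}(n)$ is finite for all $n$, and $(I_{\mathbf x}(n))_{n\ge 0}$ is $(\mathbb N,k)$-regular. -/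

import Mathlib

/-- The integer `[w]_k` represented in base `k` by the word `w` (most significant digit first). -/
def baseValue (k : ℕ) (w : List (Fin k)) : ℕ :=
  w.foldl (fun m d => k * m + (d : ℕ)) 0

/-- `w` is a canonical base-`k` expansion: it is empty or its first digit is nonzero. -/
def IsCanonicalExpansion (k : ℕ) (w : List (Fin k)) : Prop :=
  ∀ d ∈ w.head?, (d : ℕ) ≠ 0

/-- `x` is `k`-automatic: it is computed by a deterministic finite automaton with output
(finite state set `σ`, initial state `q₀`, transition function `δ`, output map `τ`) that reads
the canonical base-`k` expansion of `n` and outputs `x n`. -/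
def IsAutomatic {Δ : Type*} (k : ℕ) (x : ℕ → Δ) : Prop :=
  ∃ (σ : Type) (_ : Finite σ) (q₀ : σ) (δ : σ → Fin k → σ) (τ : σ → Δ),
    ∀ w : List (Fin k), IsCanonicalExpansion k w → x (baseValue k w) = τ (w.foldl δ q₀)

/-- `f` is `(R, k)`-regular: there are finitely many sequences `F 0, …, F (r - 1)` such that
`f` is an `R`-linear combination of them, and each `n ↦ F i (k n + a)` with `0 ≤ a < k` is an
`R`-linear combination of them as well. -/
def IsRegularSeq (R : Type*) [Semiring R] (k : ℕ) (f : ℕ → R) : Prop :=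
  ∃ (r : ℕ) (F : Fin r → ℕ → R),
    f ∈ Submodule.span R (Set.range F) ∧
      ∀ i : Fin r, ∀ a : ℕ, a < k →
        (fun n => F i (k * n + a)) ∈ Submodule.span R (Set.range F)

/-- The factor `x[i..i+n-1]` of length `n` that begins at position `i` of the infinite word `x`. -/
def factorAt {Δ : Type*} (x : ℕ → Δ) (i n : ℕ) : List Δ :=
  (List.range n).map fun m => x (i + m)

/-- The least element of a set of natural numbers, and `∞` if the set is empty. -/
noncomputable def leastOrTop (S : Set ℕ) : ℕ∞ :=
  sInf ((fun t : ℕ => (t : ℕ∞)) '' S)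

/-- The recurrence function: the least `t` such that every factor of length `t` of `x`
contains every factor of length `n` of `x` as a factor. -/
noncomputable def recurrenceFunction {Δ : Type*} (x : ℕ → Δ) (n : ℕ) : ℕ∞ :=
  leastOrTop {t : ℕ | ∀ i j : ℕ, factorAt x j n <:+: factorAt x i t}

/-- The appearance function: the least `t` such that every factor of length `n` of `x`
appears in the prefix of length `t` of `x`. -/
noncomputable def appearanceFunction {Δ : Type*} (x : ℕ → Δ) (n : ℕ) : ℕ∞ :=
  leastOrTop {t : ℕ | ∀ j : ℕ, factorAt x j n <:+: factorAt x 0 t}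

/-- The separator length: the least length of a factor that begins at position `n` of `x` and
does not occur at any earlier position. -/
noncomputable def separatorLength {Δ : Type*} (x : ℕ → Δ) (n : ℕ) : ℕ∞ :=
  leastOrTop {t : ℕ | ∀ j < n, factorAt x j t ≠ factorAt x n t}

/-- The repetitivity index: the least distance between two consecutive occurrences, at
positions `i < j`, of the same factor of length `n`. -/
noncomputable def repetitivityIndex {Δ : Type*} (x : ℕ → Δ) (n : ℕ) : ℕ∞ :=
  leastOrTop {d : ℕ | ∃ i j : ℕ, i < j ∧ j = i + d ∧ factorAt x j n = factorAt x i n ∧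
    ∀ m : ℕ, i < m → m < j → factorAt x m n ≠ factorAt x i n}

/-- `x` is ultimately periodic. -/
def IsUltimatelyPeriodic {Δ : Type*} (x : ℕ → Δ) : Prop :=
  ∃ p N : ℕ, 0 < p ∧ ∀ n : ℕ, N ≤ n → x (n + p) = x n

/-! Each of the four functions is `n ↦ min S(n)`, where `t ∈ S(n)` is a first-order formula built
from `+`, `≤` and the relation `x i = x j`. These atoms have finite `k`-kernels, and Boolean
operations and quantifiers preserve this property (`IsRecognizable.exists_pair` is the subset
construction), so `t ∈ S(n)` is recognizable.

The minimum becomes a count: `min S` is the number of `s` smaller than every element of `S`, which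
is `∞` if `S` is empty (`leastOrTop_eq_encard`). Counting the fibres of a recognizable relation
gives a regular sequence, because splitting `m` by its last digit writes the count at `k * n + a` as
a sum of `k` counts at `n` (`IsRecognizable.isRegularSeq_encard`, and `isRegularSeq_ncard` over
`ℕ`). Finiteness of the values is pigeonhole. -/

/-! ### Predicates with finite kernel and their closure properties -/

/-- A type whose elements are represented in base `k`: `append k a d` appends the digit `d` to the
least significant end of the representation of `a`. -/
class DigitSystem (k : ℕ) (α : Type) where
  /-- The type of digits. -/
  Digit : Type
  /-- Append a digit at the least significant end. -/
  append : α → Digit → α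

namespace DigitSystem

instance instNat (k : ℕ) : DigitSystem k ℕ where
  Digit := Fin k
  append n a := k * n + a

instance instProd (k : ℕ) (α β : Type) [DigitSystem k α] [DigitSystem k β] :
    DigitSystem k (α × β) where
  Digit := Digit k α × Digit k β
  append p d := (append p.1 d.1, append p.2 d.2)

end DigitSystem

open DigitSystem in
/-- `P` belongs to a finite family of predicates that is closed under appending digits, that is,
`P` has a finite `k`-kernel. -/
def IsRecognizable (k : ℕ) {α : Type} [DigitSystem k α] (P : α → Prop) : Prop :=
  ∃ (T : Type) (_ : Finite T) (F : T → α → Prop) (next : T → Digit k α → T) (t₀ : T),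
    (∀ t a d, F t (append a d) ↔ F (next t d) a) ∧ ∀ a, F t₀ a ↔ P a

/-- The graph of `f` is recognizable. -/
def IsRecognizableFun (k : ℕ) {α : Type} [DigitSystem k α] (f : α → ℕ) : Prop :=
  IsRecognizable k fun p : α × ℕ => f p.1 = p.2

open DigitSystem

namespace IsRecognizable

variable {k : ℕ} {α β : Type} [DigitSystem k α] [DigitSystem k β]

theorem congr {P Q : α → Prop} (hP : IsRecognizable k P) (h : ∀ a, P a ↔ Q a) :
    IsRecognizable k Q := by
  obtain ⟨T, hT, F, next, t₀, hF, h₀⟩ := hP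
  exact ⟨T, hT, F, next, t₀, hF, fun a => (h₀ a).trans (h a)⟩

theorem not {P : α → Prop} (hP : IsRecognizable k P) : IsRecognizable k fun a => ¬ P a := by
  obtain ⟨T, hT, F, next, t₀, hF, h₀⟩ := hP
  exact ⟨T, hT, fun t a => ¬ F t a, next, t₀, fun t a d => not_congr (hF t a d),
    fun a => not_congr (h₀ a)⟩

theorem and {P Q : α → Prop} (hP : IsRecognizable k P) (hQ : IsRecognizable k Q) :
    IsRecognizable k fun a => P a ∧ Q a := by
  obtain ⟨T, hT, F, next, t₀, hF, h₀⟩ := hP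
  obtain ⟨U, hU, G, next', u₀, hG, g₀⟩ := hQ
  exact ⟨T × U, inferInstance, fun t a => F t.1 a ∧ G t.2 a,
    fun t d => (next t.1 d, next' t.2 d), (t₀, u₀),
    fun t a d => and_congr (hF _ a d) (hG _ a d), fun a => and_congr (h₀ a) (g₀ a)⟩

theorem imp {P Q : α → Prop} (hP : IsRecognizable k P) (hQ : IsRecognizable k Q) :
    IsRecognizable k fun a => P a → Q a :=
  (hP.and hQ.not).not.congr fun a => by tauto

/-- Recognizability is preserved by preimages under maps that act digitwise. -/
theorem comp {P : β → Prop} (hP : IsRecognizable k P) {f : α → β}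
    (g : Digit k α → Digit k β) (hf : ∀ a d, f (append a d) = append (f a) (g d)) :
    IsRecognizable k fun a => P (f a) := by
  obtain ⟨T, hT, F, next, t₀, hF, h₀⟩ := hP
  refine ⟨T, hT, fun t a => F t (f a), fun t d => next t (g d), t₀, fun t a d => ?_,
    fun a => h₀ _⟩
  simp only [hf]
  exact hF _ _ _

/-- Subset construction: the last digit of the witness is guessed, and the rest is again a witness.
As the predicates concern numbers rather than words, witnesses longer than the input need no
padding. -/
theorem exists_pair [NeZero k] {P : α × ℕ → Prop} (hP : IsRecognizable k P) :
    IsRecognizable k fun a => ∃ n, P (a, n) := by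
  obtain ⟨T, hT, F, next, t₀, hF, h₀⟩ := hP
  refine ⟨Set T, inferInstance, fun s a => ∃ n, ∃ t ∈ s, F t (a, n),
    fun s d => {u | ∃ t ∈ s, ∃ b : Fin k, u = next t (d, b)}, {t₀}, fun s a d => ?_, fun a => ?_⟩
  · constructor
    · rintro ⟨n, t, ht, h⟩
      refine ⟨n / k, _, ⟨t, ht, Fin.ofNat k n, rfl⟩, (hF t (a, n / k) (d, Fin.ofNat k n)).1 ?_⟩
      have : append (k := k) (a, n / k) (d, Fin.ofNat k n) = (append a d, n) :=
        Prod.ext rfl (Nat.div_add_mod n k)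
      rwa [this]
    · rintro ⟨n, _, ⟨t, ht, b, rfl⟩, h⟩
      exact ⟨k * n + b, t, ht, (hF t (a, n) (d, b)).2 h⟩
  · simpa using exists_congr fun n => h₀ (a, n)

theorem forall_pair [NeZero k] {P : α × ℕ → Prop} (hP : IsRecognizable k P) :
    IsRecognizable k fun a => ∀ n, P (a, n) :=
  hP.not.exists_pair.not.congr fun a => by simp

/-- The curried form lets unification read `P` off a quantified formula. -/
theorem ex [NeZero k] {P : α → ℕ → Prop} (hP : IsRecognizable k fun p : α × ℕ => P p.1 p.2) :
    IsRecognizable k fun a => ∃ n, P a n :=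
  hP.exists_pair

theorem all [NeZero k] {P : α → ℕ → Prop} (hP : IsRecognizable k fun p : α × ℕ => P p.1 p.2) :
    IsRecognizable k fun a => ∀ n, P a n :=
  hP.forall_pair

/-- Addition of natural numbers is recognizable: the family keeps track of the carry. -/
theorem add_eq (hk : 2 ≤ k) : IsRecognizable k fun p : (ℕ × ℕ) × ℕ => p.1.1 + p.1.2 = p.2 := by
  classical
  refine ⟨Option Bool, inferInstance,
    -- `some e` is the sum with incoming carry `e`; `none` is the dead state, which never holds.
    fun c p => ∃ e, c = some e ∧ p.1.1 + p.1.2 + e.toNat = p.2,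
    fun c d => c.bind fun e =>
      if (d.1.1 : Fin k).val + (d.1.2 : Fin k).val + e.toNat = (d.2 : Fin k).val then some false
      else if (d.1.1 : Fin k).val + (d.1.2 : Fin k).val + e.toNat = k + (d.2 : Fin k).val
        then some true else none,
    some false, ?_, fun a => by simp⟩
  rintro (_ | e) ⟨⟨u, v⟩, w⟩ ⟨⟨a, b⟩, c⟩
  · simp
  change (∃ e', some e = some e' ∧ k * u + a.val + (k * v + b.val) + e'.toNat = k * w + c.val) ↔ _
  have ha : a.val < k := a.isLt
  have hb : b.val < k := b.isLt
  have hc : c.val < k := c.isLt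
  have he : e.toNat ≤ 1 := by cases e <;> simp
  -- The digit sum with carry is at most `2 * (k - 1) + 1`, so the outgoing carry is 0 or 1.
  have key : ∀ s : ℕ, s ≤ 2 * k - 1 → (k * u + k * v + s = k * w + c.val ↔
      (s = c.val ∧ u + v = w) ∨ (s = k + c.val ∧ u + v + 1 = w)) := by
    intro s hs
    constructor
    · intro h
      rcases lt_or_ge s k with hsk | hsk
      · have h1 : k * (u + v) + s = k * w + c.val := by rw [← h]; ring
        have h2 : u + v = w := by
          have := congrArg (· / k) h1
          simpa [Nat.mul_add_div (by omega : 0 < k), Nat.div_eq_of_lt hsk,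
            Nat.div_eq_of_lt hc] using this
        subst h2; left; exact ⟨by omega, rfl⟩
      · obtain ⟨s', rfl⟩ := Nat.exists_eq_add_of_le hsk
        have h1 : k * (u + v + 1) + s' = k * w + c.val := by rw [← h]; ring
        have h2 : u + v + 1 = w := by
          have := congrArg (· / k) h1
          simpa [Nat.mul_add_div (by omega : 0 < k), Nat.div_eq_of_lt (by omega : s' < k),
            Nat.div_eq_of_lt hc] using this
        subst h2; right; exact ⟨by omega, rfl⟩
    · rintro (⟨rfl, rfl⟩ | ⟨rfl, rfl⟩) <;> ring
  have key' := key (a.val + b.val + e.toNat) (by omega)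
  have hl : k * u + a.val + (k * v + b.val) + e.toNat = k * w + c.val ↔
      k * u + k * v + (a.val + b.val + e.toNat) = k * w + c.val := by omega
  simp only [Option.some.injEq, exists_eq_left', Option.bind_some]
  rw [hl, key']
  split_ifs with h1 h2
  · simp [h1]; omega
  · simp [h2]; omega
  · simp [h1, h2]

end IsRecognizable

/-! ### Order, and functions with recognizable graph -/

section Terms

variable {k : ℕ} {α : Type} [DigitSystem k α]

theorem IsRecognizable.le (hk : 2 ≤ k) : IsRecognizable k fun p : ℕ × ℕ => p.1 ≤ p.2 :=
  have : NeZero k := ⟨by omega⟩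
  ((IsRecognizable.add_eq hk).comp (α := (ℕ × ℕ) × ℕ) (f := fun p => ((p.1.1, p.2), p.1.2))
    (fun d : (Digit k ℕ × Digit k ℕ) × Digit k ℕ => ((d.1.1, d.2), d.1.2))
      fun _ _ => rfl).exists_pair.congr fun p => by simp [le_iff_exists_add, eq_comm]

theorem IsRecognizable.eq (hk : 2 ≤ k) : IsRecognizable k fun p : ℕ × ℕ => p.1 = p.2 :=
  ((IsRecognizable.le hk).and ((IsRecognizable.le hk).comp (f := Prod.swap) Prod.swap
    fun _ _ => rfl)).congr fun _ => le_antisymm_iff.symm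

theorem IsRecognizableFun.of_hom (hk : 2 ≤ k) {f : α → ℕ} (g : Digit k α → Digit k ℕ)
    (hf : ∀ a d, f (append a d) = append (f a) (g d)) : IsRecognizableFun k f :=
  (IsRecognizable.eq hk).comp (f := fun p : α × ℕ => (f p.1, p.2)) (fun d => (g d.1, d.2))
    fun _ _ => Prod.ext (hf _ _) rfl

/-- Substituting recognizable functions into a recognizable binary relation. -/
theorem IsRecognizable.subst₂ [NeZero k] {P : ℕ → ℕ → Prop}
    (hP : IsRecognizable k fun p : ℕ × ℕ => P p.1 p.2) {f g : α → ℕ}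
    (hf : IsRecognizableFun k f) (hg : IsRecognizableFun k g) :
    IsRecognizable k fun a => P (f a) (g a) := by
  have h1 : IsRecognizable k fun p : (α × ℕ) × ℕ => f p.1.1 = p.1.2 :=
    hf.comp (f := Prod.fst) Prod.fst fun _ _ => rfl
  have h2 : IsRecognizable k fun p : (α × ℕ) × ℕ => g p.1.1 = p.2 :=
    hg.comp (f := fun p : (α × ℕ) × ℕ => (p.1.1, p.2)) (fun d => (d.1.1, d.2)) fun _ _ => rfl
  have h3 : IsRecognizable k fun p : (α × ℕ) × ℕ => P p.1.2 p.2 :=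
    hP.comp (f := fun p : (α × ℕ) × ℕ => (p.1.2, p.2)) (fun d => (d.1.2, d.2)) fun _ _ => rfl
  -- The values of `f` and `g` are two extra variables, quantified away.
  exact (h1.and (h2.and h3)).exists_pair.exists_pair.congr fun a => by simp

theorem IsRecognizableFun.add (hk : 2 ≤ k) {f g : α → ℕ}
    (hf : IsRecognizableFun k f) (hg : IsRecognizableFun k g) :
    IsRecognizableFun k fun a => f a + g a := by
  have : NeZero k := ⟨by omega⟩
  have h1 : IsRecognizable k fun p : ((α × ℕ) × ℕ) × ℕ => f p.1.1.1 = p.1.2 :=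
    hf.comp (f := fun p : ((α × ℕ) × ℕ) × ℕ => (p.1.1.1, p.1.2)) (fun d => (d.1.1.1, d.1.2))
      fun _ _ => rfl
  have h2 : IsRecognizable k fun p : ((α × ℕ) × ℕ) × ℕ => g p.1.1.1 = p.2 :=
    hg.comp (f := fun p : ((α × ℕ) × ℕ) × ℕ => (p.1.1.1, p.2)) (fun d => (d.1.1.1, d.2))
      fun _ _ => rfl
  have h3 : IsRecognizable k fun p : ((α × ℕ) × ℕ) × ℕ => p.1.2 + p.2 = p.1.1.2 :=
    (IsRecognizable.add_eq hk).comp (f := fun p : ((α × ℕ) × ℕ) × ℕ => ((p.1.2, p.2), p.1.1.2))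
      (fun d => ((d.1.2, d.2), d.1.1.2)) fun _ _ => rfl
  exact (h1.and (h2.and h3)).exists_pair.exists_pair.congr fun a => by simp

theorem IsRecognizable.lt (hk : 2 ≤ k) : IsRecognizable k fun p : ℕ × ℕ => p.1 < p.2 :=
  ((IsRecognizable.le hk).comp (f := Prod.swap) Prod.swap fun _ _ => rfl).not.congr
    fun _ => not_le

theorem IsRecognizableFun.zero (hk : 2 ≤ k) : IsRecognizableFun k fun _ : α => 0 :=
  have : NeZero k := ⟨by omega⟩
  -- Zero is defined as the number that is `≤` every number.
  (((IsRecognizable.le hk).forall_pair).comp (f := (Prod.snd : α × ℕ → ℕ)) Prod.snd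
    fun _ _ => rfl).congr fun p =>
      ⟨fun h => (Nat.le_zero.1 (h 0)).symm, fun h _ => h ▸ Nat.zero_le _⟩

/-- A recognizable function may ignore an additional variable. -/
theorem IsRecognizableFun.comp_fst {f : α → ℕ} (hf : IsRecognizableFun k f) :
    IsRecognizableFun k fun p : α × ℕ => f p.1 :=
  IsRecognizable.comp hf (f := fun p : (α × ℕ) × ℕ => (p.1.1, p.2)) (fun d => (d.1.1, d.2))
    fun _ _ => rfl

end Terms

/-! ### From automata to recognizable equality of letters -/

section Automatic

/-- The canonical base-`k` expansion of a natural number. -/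
def canonicalExpansion (k : ℕ) (hk : 2 ≤ k) (n : ℕ) : List (Fin k) :=
  if n = 0 then [] else
    canonicalExpansion k hk (n / k) ++ [⟨n % k, Nat.mod_lt _ (by omega)⟩]
termination_by n
decreasing_by exact Nat.div_lt_self (by omega) (by omega)

variable {k : ℕ}

theorem canonicalExpansion_zero (hk : 2 ≤ k) : canonicalExpansion k hk 0 = [] := by
  rw [canonicalExpansion]; simp

theorem canonicalExpansion_append (hk : 2 ≤ k) (n : ℕ) (a : Fin k) (h : k * n + a ≠ 0) :
    canonicalExpansion k hk (k * n + a) = canonicalExpansion k hk n ++ [a] := by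
  have h1 : (k * n + a) / k = n := by
    rw [Nat.mul_add_div (by omega), Nat.div_eq_of_lt a.isLt, add_zero]
  have h2 : (k * n + a) % k = a := by
    rw [Nat.mul_add_mod, Nat.mod_eq_of_lt a.isLt]
  conv_lhs => rw [canonicalExpansion]
  simp only [if_neg h, h1, h2]

theorem baseValue_canonicalExpansion (hk : 2 ≤ k) (n : ℕ) :
    baseValue k (canonicalExpansion k hk n) = n := by
  induction n using Nat.strong_induction_on with
  | _ n ih =>
    rw [canonicalExpansion]
    split_ifs with h
    · simp [h, baseValue]
    · have := ih (n / k) (Nat.div_lt_self (by omega) (by omega))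
      simp only [baseValue, List.bind_eq_flatMap, List.flatMap_append, List.foldl_append] at this ⊢
      rw [this]
      exact Nat.div_add_mod n k

theorem isCanonicalExpansion_canonicalExpansion (hk : 2 ≤ k) (n : ℕ) :
    IsCanonicalExpansion k (canonicalExpansion k hk n) := by
  induction n using Nat.strong_induction_on with
  | _ n ih =>
    rw [canonicalExpansion]
    split_ifs with h
    · simp [IsCanonicalExpansion]
    · have := ih (n / k) (Nat.div_lt_self (by omega) (by omega))
      rcases Nat.lt_or_ge n k with hn | hn
      · rw [Nat.div_eq_of_lt hn, canonicalExpansion_zero]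
        simpa [IsCanonicalExpansion, Nat.mod_eq_of_lt hn] using h
      · have hne : canonicalExpansion k hk (n / k) ≠ [] := by
          rw [canonicalExpansion, if_neg (by have := Nat.div_pos hn (by omega); omega)]
          simp
        rw [IsCanonicalExpansion, List.head?_append_of_ne_nil _ hne]
        exact this

/-- An automatic sequence is computed by a finite automaton that tolerates leading zeros. -/
theorem IsAutomatic.exists_states {Δ : Type*} (hk : 2 ≤ k) {x : ℕ → Δ} (hx : IsAutomatic k x) :
    ∃ (σ : Type) (_ : Finite σ) (st : ℕ → σ) (δ : σ → Fin k → σ) (τ : σ → Δ),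
      (∀ n (a : Fin k), st (k * n + a) = δ (st n) a) ∧ ∀ n, x n = τ (st n) := by
  classical
  obtain ⟨σ, hσ, q₀, δ, τ, h⟩ := hx
  refine ⟨Option σ, inferInstance,
    -- `none` means that only zeros have been read; the first nonzero digit starts the automaton at
    -- `q₀`.
    fun n => if n = 0 then none else some ((canonicalExpansion k hk n).foldl δ q₀),
    fun s a => match s with
      | none => if (a : ℕ) = 0 then none else some (δ q₀ a)
      | some s => some (δ s a),
    fun s => τ (s.getD q₀), fun n a => ?_, fun n => ?_⟩
  · by_cases hn : n = 0
    · subst hn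
      by_cases ha : (a : ℕ) = 0
      · simp [ha]
      · have := canonicalExpansion_append hk 0 a (by simpa using ha)
        simp only [mul_zero, zero_add] at this
        simp [ha, this, canonicalExpansion_zero]
    · have h0 : k * n + a ≠ 0 := by
        have : 0 < k * n := Nat.mul_pos (by omega) (by omega)
        omega
      simp only [if_neg hn, if_neg h0, canonicalExpansion_append hk n a h0, List.foldl_append,
        List.foldl_cons, List.foldl_nil]
  · have := h _ (isCanonicalExpansion_canonicalExpansion hk n)
    rw [baseValue_canonicalExpansion] at this
    rw [this]
    by_cases hn : n = 0
    · simp [hn, canonicalExpansion_zero]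
    · simp [hn]

theorem IsAutomatic.isRecognizable_eq {Δ : Type*} (hk : 2 ≤ k) {x : ℕ → Δ}
    (hx : IsAutomatic k x) : IsRecognizable k fun p : ℕ × ℕ => x p.1 = x p.2 := by
  obtain ⟨σ, hσ, st, δ, τ, hδ, hτ⟩ := hx.exists_states hk
  -- Appending digits acts on pairs of states, hence by preimage on the finitely many sets of such
  -- pairs.
  refine ⟨Set (σ × σ), inferInstance, fun s p => (st p.1, st p.2) ∈ s,
    fun s d => {q | (δ q.1 d.1, δ q.2 d.2) ∈ s}, {q | τ q.1 = τ q.2}, ?_, ?_⟩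
  · rintro s ⟨m, n⟩ ⟨(a : Fin k), (b : Fin k)⟩
    change (st (k * m + a.val), st (k * n + b.val)) ∈ s ↔ _
    rw [hδ, hδ]
    rfl
  · rintro ⟨m, n⟩
    simp [hτ]

theorem IsAutomatic.finite_range {Δ : Type*} (hk : 2 ≤ k) {x : ℕ → Δ} (hx : IsAutomatic k x) :
    (Set.range x).Finite := by
  obtain ⟨σ, hσ, st, δ, τ, hδ, hτ⟩ := hx.exists_states hk
  refine (Set.finite_range τ).subset ?_
  rintro _ ⟨n, rfl⟩
  exact ⟨st n, (hτ n).symm⟩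

end Automatic

/-! ### Regular sequences from counting -/

section Regular

variable {R : Type*} [Semiring R] {k : ℕ}

theorem IsRegularSeq.of_finite {T : Type*} [Finite T] (F : T → ℕ → R) {f : ℕ → R}
    (hf : f ∈ Submodule.span R (Set.range F))
    (h : ∀ t, ∀ a < k, (fun n => F t (k * n + a)) ∈ Submodule.span R (Set.range F)) :
    IsRegularSeq R k f := by
  obtain ⟨r, ⟨e⟩⟩ := Finite.exists_equiv_fin T
  have hr : Set.range (F ∘ e.symm) = Set.range F := e.symm.surjective.range_comp F
  exact ⟨r, F ∘ e.symm, by rwa [hr], fun i a ha => by rw [hr]; exact h _ a ha⟩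

theorem IsRegularSeq.add {f g : ℕ → R} (hf : IsRegularSeq R k f) (hg : IsRegularSeq R k g) :
    IsRegularSeq R k (f + g) := by
  obtain ⟨r, F, hF, hF'⟩ := hf
  obtain ⟨s, G, hG, hG'⟩ := hg
  have h1 : Submodule.span R (Set.range F) ≤ Submodule.span R (Set.range (Sum.elim F G)) :=
    Submodule.span_mono (by simp)
  have h2 : Submodule.span R (Set.range G) ≤ Submodule.span R (Set.range (Sum.elim F G)) :=
    Submodule.span_mono (by simp)
  refine .of_finite (Sum.elim F G) (Submodule.add_mem _ (h1 hF) (h2 hG)) ?_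
  rintro (i | i) a ha
  · exact h1 (hF' i a ha)
  · exact h2 (hG' i a ha)

/-- Serves to prescribe an arbitrary value of the separator length at 0. -/
theorem isRegularSeq_single_zero (hk : 2 ≤ k) (c : R) :
    IsRegularSeq R k fun n => if n = 0 then c else 0 := by
  let F : Unit → ℕ → R := fun _ n => if n = 0 then 1 else 0
  have hF : F () ∈ Submodule.span R (Set.range F) := Submodule.subset_span ⟨(), rfl⟩
  refine .of_finite F ?_ fun t a ha => ?_
  · convert Submodule.smul_mem _ c hF using 1
    ext n
    simp [F]
  · by_cases h : a = 0
    · convert hF using 1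
      ext n
      have : k ≠ 0 := by omega
      simp [F, h, this]
    · convert Submodule.zero_mem _ using 1
      ext n
      simp [F, h]

theorem encard_setOf_append [NeZero k] (P : ℕ → Prop) :
    {m | P m}.encard = ∑ b : Fin k, {m | P (k * m + b)}.encard := by
  have hU : {m | P m} = ⋃ b : Fin k, (fun m => k * m + b) '' {m | P (k * m + b)} := by
    ext m
    simp only [Set.mem_ofPred_eq, Set.mem_iUnion, Set.mem_image]
    constructor
    · intro h
      have hm : k * (m / k) + (Fin.ofNat k m).val = m := Nat.div_add_mod m k
      exact ⟨Fin.ofNat k m, m / k, by rwa [hm], hm⟩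
    · rintro ⟨b, m, h, rfl⟩
      exact h
  have hk : 0 < k := Nat.pos_of_ne_zero (NeZero.ne k)
  rw [hU, Set.encard_iUnion_of_finite, finsum_eq_sum_of_fintype]
  · refine Finset.sum_congr rfl fun b _ => Function.Injective.encard_image ?_ _
    intro m n h
    simpa [hk.ne'] using h
  · intro b c hbc
    refine Set.disjoint_left.2 ?_
    rintro _ ⟨m, -, rfl⟩ ⟨n, -, h⟩
    apply hbc
    have := congrArg (· % k) h
    ext
    simpa [Nat.mul_add_mod, Nat.mod_eq_of_lt b.isLt, Nat.mod_eq_of_lt c.isLt] using this.symm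

theorem IsRecognizable.isRegularSeq_encard [NeZero k] {P : ℕ → ℕ → Prop}
    (hP : IsRecognizable k fun p : ℕ × ℕ => P p.1 p.2) :
    IsRegularSeq ℕ∞ k fun n => {m | P n m}.encard := by
  obtain ⟨T, hT, F, next, t₀, hF, h₀⟩ := hP
  refine .of_finite (fun t n => {m | F t (n, m)}.encard) (Submodule.subset_span ⟨t₀, ?_⟩) ?_
  · simp [h₀]
  · intro t a ha
    have : (fun n => {m | F t (k * n + a, m)}.encard) =
        ∑ b : Fin k, fun n => {m | F (next t (⟨a, ha⟩, b)) (n, m)}.encard := by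
      ext1 n
      rw [Finset.sum_apply, encard_setOf_append (k := k)]
      refine Finset.sum_congr rfl fun b _ => ?_
      congr 1
      ext m
      exact hF t (n, m) (⟨a, ha⟩, b)
    rw [this]
    exact Submodule.sum_mem _ fun b _ => Submodule.subset_span ⟨_, rfl⟩

/-- Over `ℕ` infinite counts must be excluded, so only kernel members with all fibres finite are
kept. They are closed under `next`, since each successor's fibre injects into a fibre of the
original by `hsum`. -/
theorem IsRecognizable.isRegularSeq_ncard [NeZero k] {P : ℕ → ℕ → Prop}
    (hP : IsRecognizable k fun p : ℕ × ℕ => P p.1 p.2) (hfin : ∀ n, {m | P n m}.Finite) :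
    IsRegularSeq ℕ k fun n => {m | P n m}.ncard := by
  obtain ⟨T, hT, F, next, t₀, hF, h₀⟩ := hP
  have hsum : ∀ t n (a b : Fin k), {m | F (next t (a, b)) (n, m)}.encard ≤
      {m | F t (k * n + a, m)}.encard := by
    intro t n a b
    rw [encard_setOf_append (k := k) fun m => F t (k * n + a, m)]
    refine le_trans (le_of_eq ?_)
      (Finset.single_le_sum (f := fun b : Fin k => {m | F t (k * n + a, k * m + b)}.encard)
        (fun _ _ => zero_le) (Finset.mem_univ b))
    congr 1
    ext m
    exact (hF t (n, m) (a, b)).symm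
  let T' := {t : T // ∀ n, {m | F t (n, m)}.Finite}
  refine .of_finite (fun (t : T') n => {m | F t.1 (n, m)}.ncard)
    (Submodule.subset_span ⟨⟨t₀, ?_⟩, ?_⟩) ?_
  · simpa [h₀] using hfin
  · simp [h₀]
  · rintro ⟨t, ht⟩ a ha
    have ht' : ∀ b : Fin k, ∀ n, {m | F (next t (⟨a, ha⟩, b)) (n, m)}.Finite := fun b n =>
      Set.encard_lt_top_iff.1 ((hsum t n ⟨a, ha⟩ b).trans_lt (ht _).encard_lt_top)
    have : (fun n => {m | F t (k * n + a, m)}.ncard) =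
        ∑ b : Fin k, fun n => {m | F (next t (⟨a, ha⟩, b)) (n, m)}.ncard := by
      ext1 n
      rw [Finset.sum_apply, ← Nat.cast_inj (R := ℕ∞), (ht _).cast_ncard_eq, Nat.cast_sum,
        encard_setOf_append (k := k)]
      refine Finset.sum_congr rfl fun b _ => ?_
      rw [(ht' b n).cast_ncard_eq]
      congr 1
      ext m
      exact hF t (n, m) (⟨a, ha⟩, b)
    rw [this]
    exact Submodule.sum_mem _ fun b _ => Submodule.subset_span ⟨⟨_, ht' b⟩, rfl⟩

end Regular

/-! ### Minima as counts -/

section LeastOrTop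

theorem leastOrTop_empty : leastOrTop ∅ = ⊤ := by simp [leastOrTop]

theorem leastOrTop_eq_of_isLeast {S : Set ℕ} {t : ℕ} (h : IsLeast S t) : leastOrTop S = t :=
  ((Nat.mono_cast (α := ℕ∞)).map_isLeast h).isGLB.sInf_eq

theorem leastOrTop_ne_top {S : Set ℕ} (h : S.Nonempty) : leastOrTop S ≠ ⊤ := by
  classical
  rw [leastOrTop_eq_of_isLeast (t := sInf S) ⟨Nat.sInf_mem h, fun _ => Nat.sInf_le⟩]
  simp

theorem leastOrTop_eq_encard (S : Set ℕ) : leastOrTop S = {s | ∀ t, t ∈ S → s < t}.encard := by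
  rcases S.eq_empty_or_nonempty with rfl | h
  · simp [leastOrTop_empty]
  · have hl : IsLeast S (sInf S) := ⟨Nat.sInf_mem h, fun _ => Nat.sInf_le⟩
    rw [leastOrTop_eq_of_isLeast hl]
    have : {s | ∀ t, t ∈ S → s < t} = ((Finset.range (sInf S) : Finset ℕ) : Set ℕ) := by
      ext s
      simp only [Set.mem_ofPred_eq, Finset.coe_range, Set.mem_Iio]
      exact ⟨fun h => h _ hl.1, fun h t ht => h.trans_le (hl.2 ht)⟩
    rw [this, Set.encard_coe_eq_coe_finsetCard, Finset.card_range]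

variable {k : ℕ} {S : ℕ → Set ℕ}

theorem IsRecognizable.lt_all_mem (hk : 2 ≤ k)
    (hS : IsRecognizable k fun p : ℕ × ℕ => p.2 ∈ S p.1) :
    IsRecognizable k fun p : ℕ × ℕ => ∀ t, t ∈ S p.1 → p.2 < t := by
  have : NeZero k := ⟨by omega⟩
  have h1 : IsRecognizable k fun p : (ℕ × ℕ) × ℕ => p.2 ∈ S p.1.1 :=
    hS.comp (f := fun p : (ℕ × ℕ) × ℕ => (p.1.1, p.2)) (fun d => (d.1.1, d.2)) fun _ _ => rfl
  have h2 : IsRecognizable k fun p : (ℕ × ℕ) × ℕ => p.2 ≤ p.1.2 :=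
    (IsRecognizable.le hk).comp (f := fun p : (ℕ × ℕ) × ℕ => (p.2, p.1.2))
      (fun d => (d.2, d.1.2)) fun _ _ => rfl
  exact (h1.imp h2.not).forall_pair.congr fun p => by simp

theorem isRegularSeq_leastOrTop (hk : 2 ≤ k)
    (hS : IsRecognizable k fun p : ℕ × ℕ => p.2 ∈ S p.1) :
    IsRegularSeq ℕ∞ k fun n => leastOrTop (S n) := by
  have : NeZero k := ⟨by omega⟩
  simp only [leastOrTop_eq_encard]
  exact (hS.lt_all_mem hk).isRegularSeq_encard

theorem isRegularSeq_of_eq_leastOrTop (hk : 2 ≤ k)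
    (hS : IsRecognizable k fun p : ℕ × ℕ => p.2 ∈ S p.1) {f : ℕ → ℕ}
    (hf : ∀ n, leastOrTop (S n) = f n) : IsRegularSeq ℕ k f := by
  have : NeZero k := ⟨by omega⟩
  simp only [leastOrTop_eq_encard] at hf
  have hfin : ∀ n, {s | ∀ t, t ∈ S n → s < t}.Finite := fun n => by
    rw [← Set.encard_lt_top_iff, hf]
    exact ENat.natCast_lt_top _
  convert (hS.lt_all_mem hk).isRegularSeq_ncard hfin using 2 with n
  rw [Set.ncard, hf, ENat.toNat_natCast]

end LeastOrTop

/-! ### Factors and finiteness of the four functions -/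

section Factors

variable {Δ : Type*} {x : ℕ → Δ}

theorem length_factorAt (i n : ℕ) : (factorAt x i n).length = n := by simp [factorAt]

theorem factorAt_eq_iff {i j n : ℕ} :
    factorAt x i n = factorAt x j n ↔ ∀ m, m < n → x (i + m) = x (j + m) := by
  simp [factorAt]

theorem factorAt_add (i m n : ℕ) :
    factorAt x i (m + n) = factorAt x i m ++ factorAt x (i + m) n := by
  simp [factorAt, List.range_add, Function.comp_def, add_assoc]

theorem factorAt_isInfix_iff {i j n t : ℕ} :
    factorAt x j n <:+: factorAt x i t ↔
      ∃ q, q + n ≤ t ∧ ∀ m, m < n → x (j + m) = x (i + q + m) := by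
  simp only [← factorAt_eq_iff]
  constructor
  · rintro ⟨u, v, h⟩
    have hlen := congrArg List.length h
    simp only [List.length_append, length_factorAt] at hlen
    obtain rfl : t = u.length + n + v.length := hlen.symm
    refine ⟨u.length, by omega, ?_⟩
    rw [factorAt_add, factorAt_add] at h
    have h1 := List.append_inj_left h (by simp [length_factorAt])
    exact List.append_inj_right h1 (by simp [length_factorAt])
  · rintro ⟨q, hq, h⟩
    obtain ⟨r, rfl⟩ := Nat.exists_eq_add_of_le hq
    rw [h, factorAt_add, factorAt_add]
    exact ⟨_, _, rfl⟩

theorem finite_range_factorAt (hx : (Set.range x).Finite) (n : ℕ) :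
    (Set.range fun i => factorAt x i n).Finite := by
  have : Finite (Set.range x) := hx
  refine ((List.finite_length_eq (Set.range x) n).image (List.map Subtype.val)).subset ?_
  rintro _ ⟨i, rfl⟩
  refine ⟨factorAt (Set.rangeFactorization x) i n, length_factorAt _ _, ?_⟩
  simp [factorAt, Function.comp_def, Set.rangeFactorization]

theorem appearanceFunction_ne_top (hx : (Set.range x).Finite) (n : ℕ) :
    appearanceFunction x n ≠ ⊤ := by
  apply leastOrTop_ne_top
  have hfin := finite_range_factorAt hx n
  -- `g` picks one occurrence of each of the finitely many factors, so these positions are bounded.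
  choose! g hg using fun (w : List Δ) (hw : w ∈ Set.range fun i => factorAt x i n) => hw
  obtain ⟨b, hb⟩ := (hfin.image g).bddAbove
  refine ⟨b + n, fun j => factorAt_isInfix_iff.2 ⟨g (factorAt x j n), ?_, ?_⟩⟩
  · exact Nat.add_le_add_right (hb ⟨_, ⟨j, rfl⟩, rfl⟩) n
  · rw [← factorAt_eq_iff, zero_add]
    exact (hg _ ⟨j, rfl⟩).symm

theorem repetitivityIndex_ne_top (hx : (Set.range x).Finite) (n : ℕ) :
    repetitivityIndex x n ≠ ⊤ := by
  classical
  apply leastOrTop_ne_top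
  have : Finite (Set.range fun i => factorAt x i n) := finite_range_factorAt hx n
  obtain ⟨i, j, hij, h⟩ := Finite.exists_ne_map_eq_of_infinite
    (Set.rangeFactorization fun i => factorAt x i n)
  replace h : factorAt x i n = factorAt x j n := congrArg Subtype.val h
  have hex : ∃ i j, i < j ∧ factorAt x j n = factorAt x i n := by
    rcases lt_or_gt_of_ne hij with hlt | hlt
    · exact ⟨i, j, hlt, h.symm⟩
    · exact ⟨j, i, hlt, h⟩
  clear! i j
  obtain ⟨i, hex⟩ := hex
  have hj := Nat.find_spec hex
  -- The least later occurrence is the next one, so the two are consecutive.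
  refine ⟨Nat.find hex - i, i, Nat.find hex, hj.1, by omega, hj.2, fun m him hm heq => ?_⟩
  exact Nat.find_min hex hm ⟨him, heq⟩

/-- Without a separator, every length `t` has an earlier position whose factor agrees. Some `j < n`
serves infinitely many `t`, so the tails at `j` and `n` coincide and `n - j` is a period. -/
theorem separatorLength_ne_top (hx : ¬ IsUltimatelyPeriodic x) (n : ℕ) :
    separatorLength x n ≠ ⊤ := by
  apply leastOrTop_ne_top
  by_contra hempty
  have hall : ∀ t, ∃ j : Fin n, factorAt x j t = factorAt x n t := by
    intro t
    by_contra h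
    exact hempty ⟨t, fun j hj he => h ⟨⟨j, hj⟩, he⟩⟩
  choose g hg using hall
  obtain ⟨j, hj⟩ := Finite.exists_infinite_fiber g
  refine hx ⟨n - j, j, by omega, fun m hm => ?_⟩
  obtain ⟨t, ht, hmt⟩ := (Set.infinite_coe_iff.1 hj).exists_gt m
  obtain rfl : g t = j := ht
  have := factorAt_eq_iff.1 (hg t) (m - g t) (by omega)
  rw [show (g t : ℕ) + (m - g t) = m by omega] at this
  rw [this]
  congr 1
  omega

theorem separatorLength_zero (x : ℕ → Δ) : separatorLength x 0 = 0 :=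
  leastOrTop_eq_of_isLeast (t := 0) ⟨by simp, fun _ _ => Nat.zero_le _⟩

end Factors

/-! ### Recognizability of equality and containment of factors -/

section Relations

variable {Δ : Type*} {x : ℕ → Δ} {k : ℕ} {α : Type} [DigitSystem k α]

theorem IsAutomatic.isRecognizable_factorAt_eq (hk : 2 ≤ k) (hx : IsAutomatic k x)
    {i j n : α → ℕ} (hi : IsRecognizableFun k i) (hj : IsRecognizableFun k j)
    (hn : IsRecognizableFun k n) :
    IsRecognizable k fun a => factorAt x (i a) (n a) = factorAt x (j a) (n a) := by
  have : NeZero k := ⟨by omega⟩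
  have hm : IsRecognizableFun k (Prod.snd : α × ℕ → ℕ) := .of_hom hk Prod.snd fun _ _ => rfl
  simp only [factorAt_eq_iff]
  exact .all (.imp (.subst₂ (.lt hk) hm hn.comp_fst)
    (.subst₂ (P := fun u v => x u = x v) (hx.isRecognizable_eq hk)
      (.add hk hi.comp_fst hm) (.add hk hj.comp_fst hm)))

theorem IsAutomatic.isRecognizable_isInfix (hk : 2 ≤ k) (hx : IsAutomatic k x)
    {i j n t : α → ℕ} (hi : IsRecognizableFun k i) (hj : IsRecognizableFun k j)
    (hn : IsRecognizableFun k n) (ht : IsRecognizableFun k t) :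
    IsRecognizable k fun a => factorAt x (j a) (n a) <:+: factorAt x (i a) (t a) := by
  have : NeZero k := ⟨by omega⟩
  have hq : IsRecognizableFun k (Prod.snd : α × ℕ → ℕ) := .of_hom hk Prod.snd fun _ _ => rfl
  simp only [factorAt_isInfix_iff, ← factorAt_eq_iff]
  exact .ex (.and (.subst₂ (.le hk) (.add hk hq hn.comp_fst) ht.comp_fst)
    (hx.isRecognizable_factorAt_eq hk hj.comp_fst (.add hk hi.comp_fst hq) hn.comp_fst))

end Relations

theorem mainTheorem10 {Δ : Type*} (k : ℕ) (hk : 2 ≤ k) (x : ℕ → Δ) (hx : IsAutomatic k x) :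
    -- the recurrence function
    IsRegularSeq ℕ∞ k (recurrenceFunction x) ∧
    -- the appearance function, which is finite
    (∃ A : ℕ → ℕ, (∀ n, appearanceFunction x n = (A n : ℕ∞)) ∧ IsRegularSeq ℕ k A) ∧
    -- the separator length at positions n ≥ 1, with any value at n = 0:
    -- for arbitrary x with values in ℕ∞; finite and with values in ℕ unless x is
    -- ultimately periodic
    (∀ S : ℕ → ℕ∞, (∀ n, 1 ≤ n → S n = separatorLength x n) → IsRegularSeq ℕ∞ k S) ∧
    (¬ IsUltimatelyPeriodic x →
      (∀ n, separatorLength x n ≠ ⊤) ∧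
      ∀ S : ℕ → ℕ, (∀ n, 1 ≤ n → (S n : ℕ∞) = separatorLength x n) → IsRegularSeq ℕ k S) ∧
    -- the repetitivity index, which is finite
    (∃ I : ℕ → ℕ, (∀ n, repetitivityIndex x n = (I n : ℕ∞)) ∧ IsRegularSeq ℕ k I) := by
  have : NeZero k := ⟨by omega⟩
  have fst : IsRecognizableFun k (Prod.fst : ℕ × ℕ → ℕ) := .of_hom hk Prod.fst fun _ _ => rfl
  have snd {α : Type} [DigitSystem k α] : IsRecognizableFun k (Prod.snd : α × ℕ → ℕ) :=
    .of_hom hk Prod.snd fun _ _ => rfl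
  have hR : IsRecognizable k fun p : ℕ × ℕ =>
      p.2 ∈ {t : ℕ | ∀ i j : ℕ, factorAt x j p.1 <:+: factorAt x i t} :=
    .all (.all (hx.isRecognizable_isInfix hk snd.comp_fst snd fst.comp_fst.comp_fst
      snd.comp_fst.comp_fst))
  have hA : IsRecognizable k fun p : ℕ × ℕ =>
      p.2 ∈ {t : ℕ | ∀ j : ℕ, factorAt x j p.1 <:+: factorAt x 0 t} :=
    .all (hx.isRecognizable_isInfix hk (.zero hk) snd fst.comp_fst snd.comp_fst)
  have hS : IsRecognizable k fun p : ℕ × ℕ =>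
      p.2 ∈ {t : ℕ | ∀ j < p.1, factorAt x j t ≠ factorAt x p.1 t} :=
    .all (.imp (.subst₂ (.lt hk) snd fst.comp_fst)
      (.not (hx.isRecognizable_factorAt_eq hk snd fst.comp_fst snd.comp_fst)))
  have hI : IsRecognizable k fun p : ℕ × ℕ =>
      p.2 ∈ {d : ℕ | ∃ i j : ℕ, i < j ∧ j = i + d ∧ factorAt x j p.1 = factorAt x i p.1 ∧
        ∀ m : ℕ, i < m → m < j → factorAt x m p.1 ≠ factorAt x i p.1} :=
    have i : IsRecognizableFun k fun p : ((ℕ × ℕ) × ℕ) × ℕ => p.1.2 := snd.comp_fst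
    have n : IsRecognizableFun k fun p : ((ℕ × ℕ) × ℕ) × ℕ => p.1.1.1 := fst.comp_fst.comp_fst
    .ex (.ex (.and (.subst₂ (.lt hk) i snd) (.and
      (.subst₂ (.eq hk) snd (.add hk i snd.comp_fst.comp_fst)) (.and
      (hx.isRecognizable_factorAt_eq hk snd i n)
      (.all (.imp (.subst₂ (.lt hk) i.comp_fst snd) (.imp (.subst₂ (.lt hk) snd snd.comp_fst)
        (.not (hx.isRecognizable_factorAt_eq hk snd i.comp_fst n.comp_fst)))))))))
  have hfin := hx.finite_range hk
  refine ⟨isRegularSeq_leastOrTop hk hR, ?_, fun S hS' => ?_,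
    fun hper => ⟨separatorLength_ne_top hper, fun S hS' => ?_⟩, ?_⟩
  · have hc n := (ENat.natCast_toNat (appearanceFunction_ne_top hfin n)).symm
    exact ⟨_, hc, isRegularSeq_of_eq_leastOrTop hk hA hc⟩
  · have hreg : IsRegularSeq ℕ∞ k (separatorLength x) := isRegularSeq_leastOrTop hk hS
    -- `separatorLength x 0 = 0`, so adding `S 0` at 0 alone gives exactly `S`.
    convert hreg.add (isRegularSeq_single_zero hk (S 0)) using 1
    ext1 n
    change S n = separatorLength x n + if n = 0 then S 0 else 0
    rcases Nat.eq_zero_or_pos n with rfl | hn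
    · simp [separatorLength_zero]
    · simp [hS' n hn, hn.ne']
  · have hc n := (ENat.natCast_toNat (separatorLength_ne_top hper n)).symm
    convert (isRegularSeq_of_eq_leastOrTop hk hS hc).add (isRegularSeq_single_zero hk (S 0)) using 1
    ext1 n
    change S n = (separatorLength x n).toNat + if n = 0 then S 0 else 0
    rcases Nat.eq_zero_or_pos n with rfl | hn
    · simp [separatorLength_zero]
    · simp [← hS' n hn, hn.ne']
  · have hc n := (ENat.natCast_toNat (repetitivityIndex_ne_top hfin n)).symm
    exact ⟨_, hc, isRegularSeq_of_eq_leastOrTop hk hI hc⟩
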